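/- For a commutative ring $S$ and $p,r\in S$ with $p$ invertible, let $A_{p,r}(S)=S\langle x,y\rangle/(xy-p\,yx-r)$ be the quantized Weyl algebra, and let $\mathcal{O}(A_{p,r}(S))$ be the full subcategory of the category of left $A_{p,r}(S)$-modules consisting of the modules $M$ on which $x$ acts locally nilpotently (for every $m\in M$ there is $n\ge 0$ with $x^n m=0$). For $q\in S$ and $n\ge 1$ put $[n]_q=1+q+\dots+q^{n-1}$ (which is $\frac{1-q^n}{1-q}$ whenever $1-q$ is invertible). Corollary. Let $\mathbf{k}$ be a subfield of a commutative ring $S$, let $l\ge 1$, let $u\in\mathbf{k}$ be a primitive $l$-th root of unity, let $b\in S$ be nilpotent, and let $q=u+b$. Then the category $\mathcal{O}(A_{q,1}(S))$ is equivalent to the category $\mathcal{O}(A_{q^l,[l]_q}(S))$. -/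

import Mathlib

open CategoryTheory

universe u v w

/-- The `q`-integer `[n]_q = 1 + q + ⋯ + q^(n-1)`, i.e. `(1 - q^n) / (1 - q)` read as a polynomial
in `q` (so that it also makes sense when `1 - q` is not invertible). -/
def qInt {S : Type u} [CommRing S] (n : ℕ) (q : S) : S :=
  ∑ i ∈ Finset.range n, q ^ i

namespace QuantizedWeyl

/-- The defining relation `x y = p y x + r` on the free algebra `S⟨x, y⟩`, where the free
generators are `x = ι 0` and `y = ι 1`. -/
inductive Rel {S : Type u} [CommRing S] (p r : S) :
    FreeAlgebra S (Fin 2) → FreeAlgebra S (Fin 2) → Prop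
  | xy : Rel p r
      (FreeAlgebra.ι S 0 * FreeAlgebra.ι S 1)
      (p • (FreeAlgebra.ι S 1 * FreeAlgebra.ι S 0) + algebraMap S (FreeAlgebra S (Fin 2)) r)

end QuantizedWeyl

/-- The quantized Weyl algebra `A_{p,r}(S) = S⟨x, y⟩ / (x y - p y x - r)`. -/
abbrev QuantizedWeyl {S : Type u} [CommRing S] (p r : S) : Type u :=
  RingQuot (QuantizedWeyl.Rel p r)

namespace QuantizedWeyl

/-- The generator `x` of `A_{p,r}(S)`. -/
def x {S : Type u} [CommRing S] (p r : S) : QuantizedWeyl p r :=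
  RingQuot.mkAlgHom S (Rel p r) (FreeAlgebra.ι S 0)

/-- The generator `y` of `A_{p,r}(S)`. -/
def y {S : Type u} [CommRing S] (p r : S) : QuantizedWeyl p r :=
  RingQuot.mkAlgHom S (Rel p r) (FreeAlgebra.ι S 1)

/-- The property of a left `A_{p,r}(S)`-module that `x` acts on it locally nilpotently. -/
def xLocallyNilpotent {S : Type u} [CommRing S] (p r : S) :
    ObjectProperty (ModuleCat.{v} (QuantizedWeyl p r)) :=
  fun M => ∀ m : M, ∃ n : ℕ, (x p r) ^ n • m = 0

/-- The category `𝒪(A_{p,r}(S))`: the full subcategory of the category of left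
`A_{p,r}(S)`-modules whose objects are the modules on which `x` acts locally nilpotently. -/
abbrev CategoryO {S : Type u} [CommRing S] (p r : S) :=
  (xLocallyNilpotent.{u, v} p r).FullSubcategory

end QuantizedWeyl

/-!
Write `p = 1 + c r`. The operator `Z = 1 + c y x` satisfies `x Z = p Z x` and `Z y = p y Z`, so `x`
and `y` move the generalized eigenspaces of `Z` for the values `p ^ i` one step down and up. On a
module in `𝒪(A_{p,r})` local nilpotency of `x` forces these eigenspaces `W_0, …, W_{l-1}` to span,
and since `p` is a primitive `l`-th root of unity up to nilpotents, their indices only matter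
modulo `l` and `x` is an isomorphism `W_{i+1} → W_i` for `0 ≤ i < l - 1`. What is left to record is
`x : W_0 → W_{l-1}` and `y : W_{l-1} → W_0`; transported to `W_0` they become `x ^ l` and an
operator `y'` with `x ^ l y' = p ^ l y' x ^ l + [l]_p r`. Conversely every module over
`A_{p^l,[l]_p r}` is the `W_0` of the module on `l` copies of it given by the same formulas.
-/

section GeneralizedEigenspaces

open Polynomial

variable {S : Type*} [CommRing S] {M : Type*} [AddCommGroup M] [Module S M]
  {M' : Type*} [AddCommGroup M'] [Module S M'] {z : Module.End S M} {w : Module.End S M'}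
  {a b c : S}

theorem isCoprime_X_sub_C_pow_of_isUnit_eval {f : S[X]} (hf : IsUnit (f.eval a)) (k : ℕ) :
    IsCoprime f ((X - C a) ^ k) := by
  obtain ⟨g, hg⟩ := X_sub_C_dvd_sub_C_eval (a := a) (p := f)
  obtain ⟨d, hd⟩ := hf.exists_left_inv
  have hCd : C d * C (f.eval a) = 1 := by rw [← C_mul, hd, C_1]
  exact IsCoprime.pow_right ⟨C d, -(C d * g), by linear_combination C d * hg + hCd⟩

theorem mem_maxGenEigenspace_iff_exists_aeval {m : M} :
    m ∈ z.maxGenEigenspace a ↔ ∃ k : ℕ, aeval z ((X - C a) ^ k) m = 0 := by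
  simp [Module.End.mem_maxGenEigenspace, Algebra.algebraMap_eq_smul_one]

theorem map_mem_maxGenEigenspace {f : M →ₗ[S] M'} (h : f ∘ₗ z = w ∘ₗ f) {m : M}
    (hm : m ∈ z.maxGenEigenspace a) : f m ∈ w.maxGenEigenspace a := by
  obtain ⟨k, hk⟩ := (Module.End.mem_maxGenEigenspace z a m).1 hm
  have hsub : (w - a • 1) ∘ₗ f = f ∘ₗ (z - a • 1) := by
    rw [LinearMap.sub_comp, ← h, LinearMap.comp_sub, LinearMap.smul_comp, LinearMap.comp_smul]
    rfl
  have hpow : ((w - a • 1) ^ k) ∘ₗ f = f ∘ₗ ((z - a • 1) ^ k) :=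
    Module.End.commute_pow_left_of_commute hsub k
  refine (Module.End.mem_maxGenEigenspace w a _).2 ⟨k, ?_⟩
  rw [← LinearMap.comp_apply, hpow, LinearMap.comp_apply, hk, map_zero]

theorem maxGenEigenspace_smul (z : Module.End S M) (hc : IsUnit c) (a : S) :
    (c • z).maxGenEigenspace (c * a) = z.maxGenEigenspace a := by
  ext m
  have hsub : c • z - (c * a) • (1 : Module.End S M) = c • (z - a • 1) := by
    rw [smul_sub, smul_smul]
  simp only [Module.End.mem_maxGenEigenspace, hsub, _root_.smul_pow, LinearMap.smul_apply,
    (hc.pow _).smul_eq_zero]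

theorem maxGenEigenspace_le_of_isNilpotent_sub (z : Module.End S M) (h : IsNilpotent (b - a)) :
    z.maxGenEigenspace a ≤ z.maxGenEigenspace b := by
  have htop : (0 : Module.End S M).genEigenspace (b - a) ⊤ = ⊤ := by
    obtain ⟨k, hk⟩ := h.neg
    refine eq_top_iff.2 fun m _ ↦ (Module.End.mem_maxGenEigenspace _ _ _).2 ⟨k, ?_⟩
    rw [zero_sub, ← neg_smul, _root_.smul_pow, hk, zero_smul, LinearMap.zero_apply]
  have hadd := Module.End.genEigenspace_inf_le_add z 0 a (b - a) ⊤ ⊤ (Commute.zero_right z)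
  rwa [htop, inf_top_eq, add_zero, add_sub_cancel, top_add] at hadd

theorem maxGenEigenspace_eq_of_isNilpotent_sub (z : Module.End S M) (h : IsNilpotent (a - b)) :
    z.maxGenEigenspace a = z.maxGenEigenspace b :=
  (maxGenEigenspace_le_of_isNilpotent_sub z (by simpa using h.neg)).antisymm
    (maxGenEigenspace_le_of_isNilpotent_sub z h)

theorem aeval_bijOn_maxGenEigenspace (z : Module.End S M) {f : S[X]} (hf : IsUnit (f.eval a)) :
    Set.BijOn (aeval z f) (z.maxGenEigenspace a) (z.maxGenEigenspace a) := by
  have hmaps (g : S[X]) : Set.MapsTo (aeval z g) (z.maxGenEigenspace a) (z.maxGenEigenspace a) :=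
    Module.End.mapsTo_maxGenEigenspace_of_comm (by simpa using (Commute.all X g).map (aeval z)) a
  have hinv : ∀ m ∈ z.maxGenEigenspace a, ∃ g : S[X], aeval z (g * f) m = m := by
    intro m hm
    obtain ⟨k, hk⟩ := mem_maxGenEigenspace_iff_exists_aeval.1 hm
    obtain ⟨g, g', hg⟩ := isCoprime_X_sub_C_pow_of_isUnit_eval hf k
    have hgm := congr(aeval z $hg m)
    rw [map_add, map_mul _ g', LinearMap.add_apply, Module.End.mul_apply, hk, map_zero, add_zero,
      map_one, Module.End.one_apply] at hgm
    exact ⟨g, hgm⟩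
  refine ⟨hmaps f, ?_, ?_⟩
  · refine LinearMap.injOn_of_disjoint_ker le_rfl (Submodule.disjoint_def.2 fun m hm hfm ↦ ?_)
    obtain ⟨g, hg⟩ := hinv m hm
    rw [← hg, map_mul, Module.End.mul_apply, LinearMap.mem_ker.1 hfm, map_zero]
  · intro m hm
    obtain ⟨g, hg⟩ := hinv m hm
    exact ⟨aeval z g m, hmaps g hm, by rwa [← Module.End.mul_apply, ← map_mul, mul_comm]⟩

theorem sub_smul_bijOn_maxGenEigenspace (z : Module.End S M) (h : IsUnit (a - b)) :
    Set.BijOn (z - b • 1 : Module.End S M) (z.maxGenEigenspace a) (z.maxGenEigenspace a) := by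
  have haeval : aeval z (X - C b) = z - b • 1 := by simp [Algebra.algebraMap_eq_smul_one]
  exact haeval ▸ aeval_bijOn_maxGenEigenspace z (by simpa using h)

theorem iSupIndep_maxGenEigenspace_of_isUnit_sub {ι : Type*} (z : Module.End S M) {a : ι → S}
    (ha : Pairwise fun i j ↦ IsUnit (a i - a j)) :
    iSupIndep fun i ↦ z.maxGenEigenspace (a i) := by
  intro i
  have hkilled : ∀ m ∈ ⨆ (j) (_ : j ≠ i), z.maxGenEigenspace (a j),
      ∃ f : S[X], IsUnit (f.eval (a i)) ∧ aeval z f m = 0 := by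
    intro m hm
    rw [iSup_subtype'] at hm
    induction hm using Submodule.iSup_induction' with
    | mem j m hm =>
      obtain ⟨k, hk⟩ := mem_maxGenEigenspace_iff_exists_aeval.1 hm
      exact ⟨_, by simpa using (ha j.2.symm).pow k, hk⟩
    | zero => exact ⟨1, by simp⟩
    | add m m' _ _ hm hm' =>
      obtain ⟨f, hf, hfm⟩ := hm
      obtain ⟨g, hg, hgm⟩ := hm'
      exact ⟨f * g, by simpa using hf.mul hg, by
        rw [map_add, map_mul, Module.End.mul_apply, Module.End.mul_apply, hgm,
          ← Module.End.mul_apply, ((Commute.all f g).map (aeval z)).eq, Module.End.mul_apply, hfm,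
          map_zero, map_zero, add_zero]⟩
  refine Submodule.disjoint_def.2 fun m hm hm' ↦ ?_
  obtain ⟨f, hf, hfm⟩ := hkilled m hm'
  exact (aeval_bijOn_maxGenEigenspace z hf).injOn hm (zero_mem _) (hfm.trans (map_zero _).symm)

theorem mem_iSup_maxGenEigenspace_of_sub_apply_mem {ι : Type*} {a : ι → S}
    (ha : Pairwise fun i j ↦ IsUnit (a i - a j)) (j : ι) {m : M}
    (hm : (z - a j • 1) m ∈ ⨆ i, z.maxGenEigenspace (a i)) :
    m ∈ ⨆ i, z.maxGenEigenspace (a i) := by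
  have hmap : ⨆ (i) (_ : i ≠ j), z.maxGenEigenspace (a i) ≤
      (⨆ i, z.maxGenEigenspace (a i)).map (z - a j • 1) := by
    refine iSup₂_le fun i hi e he ↦ ?_
    obtain ⟨e', he', rfl⟩ := (sub_smul_bijOn_maxGenEigenspace z (ha hi)).surjOn he
    exact ⟨e', Submodule.mem_iSup_of_mem i he', rfl⟩
  rw [iSup_split_single _ j] at hm
  obtain ⟨e, he, n, hn, hen⟩ := Submodule.mem_sup.1 hm
  obtain ⟨m', hm', rfl⟩ := hmap hn
  have hsub : (z - a j • 1) (m - m') = e := by rw [map_sub, ← hen, add_sub_cancel_right]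
  obtain ⟨k, hk⟩ := (Module.End.mem_maxGenEigenspace z _ _).1 he
  have hmem : m - m' ∈ z.maxGenEigenspace (a j) := (Module.End.mem_maxGenEigenspace z _ _).2
    ⟨k + 1, by rw [pow_succ, Module.End.mul_apply, hsub, hk]⟩
  simpa using add_mem (Submodule.mem_iSup_of_mem j hmem) hm'

end GeneralizedEigenspaces

/-- `q` is a primitive `l`-th root of unity modulo the nilradical, in the strong sense that its
lower powers differ from `1` by units (and not merely by non-nilpotent elements). -/
structure IsPrimitiveRootModNilpotent {S : Type*} [CommRing S] (q : S) (l : ℕ) : Prop where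
  pos : 0 < l
  isNilpotent_pow_sub_one : IsNilpotent (q ^ l - 1)
  isUnit_pow_sub_one : ∀ i, 0 < i → i < l → IsUnit (q ^ i - 1)

theorem isUnit_of_isNilpotent_sub {S : Type*} [CommRing S] {a b : S} (h : IsNilpotent (a - b))
    (hb : IsUnit b) : IsUnit a := by
  simpa using h.isUnit_add_left_of_commute hb (Commute.all _ _)

namespace IsPrimitiveRootModNilpotent

theorem algebraMap_add {k S : Type*} [Field k] [CommRing S] [Algebra k S] {ζ : k} {l : ℕ}
    (hζ : IsPrimitiveRoot ζ l) (hl : 0 < l) {b : S} (hb : IsNilpotent b) :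
    IsPrimitiveRootModNilpotent (algebraMap k S ζ + b) l := by
  have hpow (i : ℕ) : IsNilpotent ((algebraMap k S ζ + b) ^ i - algebraMap k S (ζ ^ i)) := by
    obtain ⟨d, hd⟩ := sub_dvd_pow_sub_pow (algebraMap k S ζ + b) (algebraMap k S ζ) i
    rw [map_pow, hd, add_sub_cancel_left]
    exact (Commute.all _ _).isNilpotent_mul_right hb
  refine ⟨hl, by simpa [hζ.pow_eq_one] using hpow l, fun i hi hil ↦ ?_⟩
  refine isUnit_of_isNilpotent_sub (b := algebraMap k S (ζ ^ i - 1)) ?_ ?_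
  · simpa using hpow i
  · exact (sub_ne_zero.2 (hζ.pow_ne_one_of_pos_of_lt hi.ne' hil)).isUnit.map _

variable {S : Type*} [CommRing S] {q : S} {l : ℕ}

theorem pow_order (h : IsPrimitiveRootModNilpotent q l) :
    IsPrimitiveRootModNilpotent (q ^ l) 1 :=
  ⟨one_pos, by simpa using h.isNilpotent_pow_sub_one, by lia⟩

variable (h : IsPrimitiveRootModNilpotent q l)
include h

theorem isUnit : IsUnit q :=
  (isUnit_pow_iff h.pos.ne').1 (isUnit_of_isNilpotent_sub h.isNilpotent_pow_sub_one isUnit_one)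

theorem isUnit_pow_sub_pow {i j : ℕ} (hji : j < i) (hil : i < l) : IsUnit (q ^ i - q ^ j) := by
  have hfac : q ^ i - q ^ j = q ^ j * (q ^ (i - j) - 1) := by
    rw [mul_sub_one, pow_mul_pow_sub q hji.le]
  rw [hfac]
  exact (h.isUnit.pow j).mul (h.isUnit_pow_sub_one _ (by lia) (by lia))

theorem pairwise_isUnit_pow_sub_pow :
    Pairwise fun i j : Fin l ↦ IsUnit (q ^ (i : ℕ) - q ^ (j : ℕ)) := by
  intro i j hij
  rcases lt_or_gt_of_ne hij with hlt | hgt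
  · exact (IsUnit.sub_iff).1 (h.isUnit_pow_sub_pow hlt j.2)
  · exact h.isUnit_pow_sub_pow hgt i.2

end IsPrimitiveRootModNilpotent

/-- A module with endomorphisms `X`, `Y` such that `X Y = p Y X + r` and `X` is locally nilpotent:
an object of `𝒪(A_{p,r}(S))` presented by operators on its underlying `S`-module. -/
structure WeylPair {S : Type u} [CommRing S] (p r : S) where
  carrier : Type v
  [addCommGroup : AddCommGroup carrier]
  [module : Module S carrier]
  X : Module.End S carrier
  Y : Module.End S carrier
  X_mul_Y : X * Y = p • (Y * X) + r • 1
  exists_X_pow_apply_eq_zero : ∀ m, ∃ k : ℕ, (X ^ k) m = 0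

namespace WeylPair

variable {S : Type u} [CommRing S] {p r : S}

attribute [instance] addCommGroup module

instance : CoeSort (WeylPair.{u, v} p r) (Type v) := ⟨carrier⟩

theorem X_Y_apply (P : WeylPair.{u, v} p r) (m : P) :
    P.X (P.Y m) = p • P.Y (P.X m) + r • m := by
  simpa using LinearMap.congr_fun P.X_mul_Y m

/-- The morphisms of `WeylPair p r`: linear maps that intertwine both operators. -/
@[ext]
structure Hom (P Q : WeylPair.{u, v} p r) where
  toLinearMap : P →ₗ[S] Q
  map_X (m : P) : toLinearMap (P.X m) = Q.X (toLinearMap m)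
  map_Y (m : P) : toLinearMap (P.Y m) = Q.Y (toLinearMap m)

instance : Category (WeylPair.{u, v} p r) where
  Hom := Hom
  id _ := ⟨LinearMap.id, fun _ ↦ rfl, fun _ ↦ rfl⟩
  comp f g := ⟨g.toLinearMap ∘ₗ f.toLinearMap, fun m ↦ by simp [f.map_X, g.map_X],
    fun m ↦ by simp [f.map_Y, g.map_Y]⟩

variable {P Q : WeylPair.{u, v} p r}

@[ext]
theorem hom_ext {f g : P ⟶ Q} (h : f.toLinearMap = g.toLinearMap) : f = g :=
  Hom.ext h

/-- An invertible linear map that intertwines both operators is an isomorphism. -/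
def isoMk (e : P ≃ₗ[S] Q) (map_X : ∀ m, e (P.X m) = Q.X (e m))
    (map_Y : ∀ m, e (P.Y m) = Q.Y (e m)) : P ≅ Q where
  hom := ⟨e, map_X, map_Y⟩
  inv := ⟨e.symm, fun m ↦ by simp [e.symm_apply_eq, map_X], fun m ↦ by
    simp [e.symm_apply_eq, map_Y]⟩
  hom_inv_id := by ext m; exact e.symm_apply_apply m
  inv_hom_id := by ext m; exact e.apply_symm_apply m

end WeylPair

namespace QuantizedWeyl

section Presentation

variable {S : Type u} [CommRing S] {p r : S}

theorem x_mul_y (p r : S) :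
    x p r * y p r = p • (y p r * x p r) + algebraMap S (QuantizedWeyl p r) r := by
  simpa [x, y] using RingQuot.mkAlgHom_rel S (Rel.xy (p := p) (r := r))

theorem induction_on {motive : QuantizedWeyl p r → Prop} (a : QuantizedWeyl p r)
    (algebraMap : ∀ s, motive (algebraMap S (QuantizedWeyl p r) s))
    (x : motive (x p r)) (y : motive (y p r))
    (add : ∀ a b, motive a → motive b → motive (a + b))
    (mul : ∀ a b, motive a → motive b → motive (a * b)) : motive a := by
  obtain ⟨a, rfl⟩ := RingQuot.mkAlgHom_surjective S (Rel p r) a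
  induction a using FreeAlgebra.induction with
  | grade0 s => simpa using algebraMap s
  | grade1 i =>
    fin_cases i
    · exact x
    · exact y
  | mul a b ha hb => simpa using mul _ _ ha hb
  | add a b ha hb => simpa using add _ _ ha hb

variable {B : Type*} [Ring B] [Algebra S B]

/-- The algebra map out of `A_{p,r}(S)` determined by a solution `X Y = p Y X + r`. -/
def lift (X Y : B) (h : X * Y = p • (Y * X) + r • 1) : QuantizedWeyl p r →ₐ[S] B :=
  RingQuot.liftAlgHom S ⟨FreeAlgebra.lift S ![X, Y], fun _ _ h' ↦ by
    cases h'
    simp [h, Algebra.algebraMap_eq_smul_one]⟩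

theorem lift_x (X Y : B) (h : X * Y = p • (Y * X) + r • 1) : lift X Y h (x p r) = X := by
  simp [lift, x]

theorem lift_y (X Y : B) (h : X * Y = p • (Y * X) + r • 1) : lift X Y h (y p r) = Y := by
  simp [lift, y]

end Presentation

section OperatorPresentation

variable {S : Type u} [CommRing S] {p r : S}

theorem map_smul_of_map_x_of_map_y {M N : Type*} [AddCommGroup M] [AddCommGroup N] [Module S M]
    [Module S N] [Module (QuantizedWeyl p r) M] [Module (QuantizedWeyl p r) N]
    [IsScalarTower S (QuantizedWeyl p r) M] [IsScalarTower S (QuantizedWeyl p r) N]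
    (f : M →ₗ[S] N) (map_x : ∀ m, f (x p r • m) = x p r • f m)
    (map_y : ∀ m, f (y p r • m) = y p r • f m) (a : QuantizedWeyl p r) (m : M) :
    f (a • m) = a • f m := by
  induction a using induction_on generalizing m with
  | algebraMap s => simp only [algebraMap_smul, map_smul]
  | x => exact map_x m
  | y => exact map_y m
  | add a b ha hb => rw [add_smul, map_add, ha, hb, add_smul]
  | mul a b ha hb => rw [mul_smul, ha, hb, mul_smul]

/-- The scalar action of `S` on a module over the `S`-algebra `A_{p,r}(S)`. -/
@[reducible]
def moduleBase (M : CategoryO.{u, v} p r) : Module S M.obj :=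
  Module.restrictScalars S (QuantizedWeyl p r) M.obj

attribute [local instance] moduleBase

theorem isScalarTower_moduleBase (M : CategoryO.{u, v} p r) :
    IsScalarTower S (QuantizedWeyl p r) M.obj :=
  IsScalarTower.restrictScalars S (QuantizedWeyl p r) M.obj

attribute [local instance] isScalarTower_moduleBase

/-- The functor sending an object of `𝒪(A_{p,r}(S))` to the operators by which `x` and `y` act. -/
def toWeylPair (p r : S) : CategoryO.{u, v} p r ⥤ WeylPair.{u, v} p r where
  obj M :=
    { carrier := M.obj
      X := Algebra.lsmul S S M.obj (x p r)
      Y := Algebra.lsmul S S M.obj (y p r)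
      X_mul_Y := by
        rw [← map_mul, x_mul_y, map_add, map_smul, map_mul, AlgHom.commutes,
          Algebra.algebraMap_eq_smul_one]
      exists_X_pow_apply_eq_zero := fun m ↦ by simpa [← map_pow] using M.property m }
  map f := ⟨f.hom.hom.restrictScalars S, f.hom.hom.map_smul _, f.hom.hom.map_smul _⟩

instance : (toWeylPair.{u, v} p r).Faithful where
  map_injective {M N} f g h := by
    ext m
    exact LinearMap.congr_fun (congrArg WeylPair.Hom.toLinearMap h) m

instance : (toWeylPair.{u, v} p r).Full where
  map_surjective {M N} g := by
    let f : M.obj →ₗ[S] N.obj := g.toLinearMap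
    exact ⟨ObjectProperty.homMk (ModuleCat.ofHom
      { f with map_smul' := map_smul_of_map_x_of_map_y f g.map_X g.map_Y }), rfl⟩

instance : (toWeylPair.{u, v} p r).EssSurj where
  mem_essImage P := by
    let : Module (QuantizedWeyl p r) P := Module.compHom P (lift P.X P.Y P.X_mul_Y).toRingHom
    have x_smul (m : P) : x p r • m = P.X m := congr($(lift_x P.X P.Y P.X_mul_Y) m)
    have y_smul (m : P) : y p r • m = P.Y m := congr($(lift_y P.X P.Y P.X_mul_Y) m)
    have algebraMap_smul (s : S) (m : P) : algebraMap S (QuantizedWeyl p r) s • m = s • m :=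
      congr($((lift P.X P.Y P.X_mul_Y).commutes s) m)
    have x_pow_smul (k : ℕ) (m : P) : x p r ^ k • m = (P.X ^ k) m := by
      change lift P.X P.Y P.X_mul_Y (x p r ^ k) m = _
      rw [map_pow, lift_x]
    let M : CategoryO.{u, v} p r := ⟨ModuleCat.of (QuantizedWeyl p r) P, fun m ↦ by
      obtain ⟨k, hk⟩ := P.exists_X_pow_apply_eq_zero m
      exact ⟨k, (x_pow_smul k m).trans hk⟩⟩
    exact ⟨M, ⟨WeylPair.isoMk
      { AddEquiv.refl P with map_smul' := algebraMap_smul } x_smul y_smul⟩⟩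

instance : (toWeylPair.{u, v} p r).IsEquivalence where

end OperatorPresentation

end QuantizedWeyl

namespace WeylPair

section Weights

variable {S : Type u} [CommRing S] {p r c : S} {l : ℕ} (P : WeylPair.{u, v} p r)

/-- The operator `1 + c Y X`; when `1 + c r = p` it commutes with `X` and `Y` up to the factor
`p`. -/
def gradingOp (c : S) : Module.End S P := 1 + c • (P.Y * P.X)

theorem gradingOp_apply (c : S) (m : P) : P.gradingOp c m = m + c • P.Y (P.X m) := rfl

theorem X_gradingOp_apply (hc : 1 + c * r = p) (m : P) :
    P.X (P.gradingOp c m) = p • P.gradingOp c (P.X m) := by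
  simp only [gradingOp_apply, map_add, map_smul, X_Y_apply, ← hc]
  module

theorem gradingOp_Y_apply (hc : 1 + c * r = p) (m : P) :
    P.gradingOp c (P.Y m) = p • P.Y (P.gradingOp c m) := by
  simp only [gradingOp_apply, map_add, map_smul, X_Y_apply, ← hc]
  module

/-- The weight-`i` part of a Weyl pair: the generalized eigenspace of `1 + c Y X` for `p ^ i`. -/
def weightSpace (c : S) (i : ℕ) : Submodule S P := (P.gradingOp c).maxGenEigenspace (p ^ i)

variable {P}

theorem X_mem_weightSpace (hc : 1 + c * r = p) (hp : IsUnit p) {i : ℕ} {m : P}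
    (hm : m ∈ P.weightSpace c (i + 1)) : P.X m ∈ P.weightSpace c i := by
  have hX : P.X ∘ₗ P.gradingOp c = (p • P.gradingOp c) ∘ₗ P.X :=
    LinearMap.ext (P.X_gradingOp_apply hc)
  rw [weightSpace, ← maxGenEigenspace_smul _ hp, ← pow_succ']
  exact map_mem_maxGenEigenspace hX hm

theorem Y_mem_weightSpace (hc : 1 + c * r = p) (hp : IsUnit p) {i : ℕ} {m : P}
    (hm : m ∈ P.weightSpace c i) : P.Y m ∈ P.weightSpace c (i + 1) := by
  have hY : P.Y ∘ₗ (p • P.gradingOp c) = P.gradingOp c ∘ₗ P.Y :=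
    LinearMap.ext fun m ↦ by simp [P.gradingOp_Y_apply hc]
  rw [weightSpace, ← maxGenEigenspace_smul _ hp, ← pow_succ'] at hm
  exact map_mem_maxGenEigenspace hY hm

theorem X_bijOn_weightSpace (hc : 1 + c * r = p) (hp : IsUnit p) {i : ℕ}
    (hi : IsUnit (p ^ (i + 1) - 1)) :
    Set.BijOn P.X (P.weightSpace c (i + 1)) (P.weightSpace c i) := by
  refine ⟨fun m ↦ X_mem_weightSpace hc hp, ?_, fun m hm ↦ ?_⟩
  · refine LinearMap.injOn_of_disjoint_ker le_rfl (Submodule.disjoint_def.2 fun m hm hXm ↦ ?_)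
    have hfix : (P.gradingOp c - (1 : S) • 1) m = 0 := by
      simp [gradingOp_apply, LinearMap.mem_ker.1 hXm]
    exact (sub_smul_bijOn_maxGenEigenspace _ hi).injOn hm (zero_mem _) (by simpa using hfix)
  · have hpi : IsUnit (p * p ^ i - 1) := by rwa [← pow_succ']
    obtain ⟨m', hm', rfl⟩ := (sub_smul_bijOn_maxGenEigenspace (p • P.gradingOp c) hpi).surjOn
      ((maxGenEigenspace_smul _ hp _).ge hm)
    rw [maxGenEigenspace_smul _ hp] at hm'
    refine ⟨c • P.Y m', Submodule.smul_mem _ _ (Y_mem_weightSpace hc hp hm'), ?_⟩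
    simp only [LinearMap.sub_apply, LinearMap.smul_apply, gradingOp_apply, map_smul, X_Y_apply,
      Module.End.one_apply, ← hc]
    module

theorem Hom.map_mem_weightSpace {Q : WeylPair.{u, v} p r} (f : P ⟶ Q) {i : ℕ} {m : P}
    (hm : m ∈ P.weightSpace c i) : f.toLinearMap m ∈ Q.weightSpace c i :=
  map_mem_maxGenEigenspace
    (LinearMap.ext fun m ↦ by simp [gradingOp_apply, f.map_X, f.map_Y]) hm

variable (hc : 1 + c * r = p) (hp : IsPrimitiveRootModNilpotent p l)

include hp in
theorem weightSpace_add_order (P : WeylPair.{u, v} p r) (c : S) (i : ℕ) :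
    P.weightSpace c (i + l) = P.weightSpace c i := by
  refine maxGenEigenspace_eq_of_isNilpotent_sub _ ?_
  rw [pow_add, ← mul_sub_one]
  exact (Commute.all _ _).isNilpotent_mul_left hp.isNilpotent_pow_sub_one

include hp in
theorem iSupIndep_weightSpace (P : WeylPair.{u, v} p r) (c : S) :
    iSupIndep fun i : Fin l ↦ P.weightSpace c i :=
  iSupIndep_maxGenEigenspace_of_isUnit_sub _ hp.pairwise_isUnit_pow_sub_pow

include hc hp

theorem Y_mem_iSup_weightSpace {m : P} (hm : m ∈ ⨆ i : Fin l, P.weightSpace c i) :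
    P.Y m ∈ ⨆ i : Fin l, P.weightSpace c i := by
  induction hm using Submodule.iSup_induction' with
  | mem i m hm =>
    have hY := Y_mem_weightSpace hc hp.isUnit hm
    rcases Nat.lt_or_eq_of_le (Nat.succ_le_of_lt i.2) with hi | hi
    · exact Submodule.mem_iSup_of_mem ⟨i + 1, hi⟩ hY
    · rw [← Nat.succ_eq_add_one, hi, ← zero_add l, weightSpace_add_order hp] at hY
      exact Submodule.mem_iSup_of_mem (p := fun i : Fin l ↦ P.weightSpace c i) ⟨0, hp.pos⟩ hY
  | zero => simp
  | add m m' _ _ hm hm' => simpa using add_mem hm hm'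

theorem iSup_weightSpace_eq_top : ⨆ i : Fin l, P.weightSpace c i = ⊤ := by
  refine eq_top_iff.2 fun m _ ↦ ?_
  obtain ⟨k, hk⟩ := P.exists_X_pow_apply_eq_zero m
  induction k generalizing m with
  | zero => simp_all
  | succ k ih =>
    have hXm : P.X m ∈ ⨆ i : Fin l, P.weightSpace c i :=
      ih (P.X m) trivial (by rwa [← Module.End.mul_apply, ← pow_succ])
    refine mem_iSup_maxGenEigenspace_of_sub_apply_mem hp.pairwise_isUnit_pow_sub_pow
      ⟨0, hp.pos⟩ ?_
    have hsub : (P.gradingOp c - p ^ 0 • 1) m = c • P.Y (P.X m) := by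
      simp [gradingOp_apply]
    rw [hsub]
    exact Submodule.smul_mem _ _ (Y_mem_iSup_weightSpace hc hp hXm)

theorem X_pow_bijOn_weightSpace {i : ℕ} (hi : i < l) :
    Set.BijOn (P.X ^ i) (P.weightSpace c i) (P.weightSpace c 0) := by
  induction i with
  | zero => exact Set.bijOn_id _
  | succ i ih =>
    rw [pow_succ]
    exact (ih (by lia)).comp
      (X_bijOn_weightSpace hc hp.isUnit (hp.isUnit_pow_sub_one _ i.succ_pos hi))

/-- The power `X ^ i` as an isomorphism from the weight-`i` part onto the weight-`0` part. -/
noncomputable def weightSpaceEquiv (i : Fin l) : P.weightSpace c i ≃ₗ[S] P.weightSpace c 0 :=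
  LinearEquiv.ofBijective ((P.X ^ (i : ℕ)).restrict (X_pow_bijOn_weightSpace hc hp i.2).mapsTo)
    (X_pow_bijOn_weightSpace hc hp i.2).bijective

/-- The copy of the weight-`0` part inside the weight-`i` part, along the inverse of `X ^ i`. -/
noncomputable def weightSection (i : Fin l) : P.weightSpace c 0 →ₗ[S] P :=
  (P.weightSpace c i).subtype ∘ₗ (weightSpaceEquiv hc hp i).symm.toLinearMap

theorem weightSection_mem (i : Fin l) (ν : P.weightSpace c 0) :
    weightSection hc hp i ν ∈ P.weightSpace c i :=
  Subtype.property _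

theorem X_pow_weightSection (i : Fin l) (ν : P.weightSpace c 0) :
    (P.X ^ (i : ℕ)) (weightSection hc hp i ν) = ν :=
  congrArg Subtype.val ((weightSpaceEquiv hc hp i).apply_symm_apply ν)

theorem weightSection_eq_iff {i : Fin l} {ν : P.weightSpace c 0} {m : P}
    (hm : m ∈ P.weightSpace c i) :
    weightSection hc hp i ν = m ↔ (P.X ^ (i : ℕ)) m = ν := by
  rw [← (X_pow_bijOn_weightSpace hc hp i.2).injOn.eq_iff (weightSection_mem hc hp i ν) hm,
    X_pow_weightSection, eq_comm]

theorem sum_weightSection_bijective :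
    Function.Bijective (∑ i : Fin l, weightSection hc hp i ∘ₗ LinearMap.proj i :
      (Fin l → P.weightSpace c 0) →ₗ[S] P) := by
  constructor
  · refine (injective_iff_map_eq_zero _).2 fun v hv ↦ ?_
    have hzero (i : Fin l) : weightSection hc hp i (v i) = 0 :=
      (iSupIndep_iff_finsetSum_eq_zero_imp_eq_zero _).1 (iSupIndep_weightSpace hp P c) Finset.univ _
        (fun i _ ↦ weightSection_mem hc hp i (v i)) (by simpa using hv) i (Finset.mem_univ i)
    ext i
    rw [← X_pow_weightSection hc hp i, hzero, map_zero, Pi.zero_apply, ZeroMemClass.coe_zero]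
  · rw [← LinearMap.range_eq_top, ← top_le_iff, ← iSup_weightSpace_eq_top hc hp]
    refine iSup_le fun i m hm ↦ ?_
    have hsection : weightSection hc hp i (weightSpaceEquiv hc hp i ⟨m, hm⟩) = m :=
      (weightSection_eq_iff hc hp hm).2 rfl
    refine ⟨Pi.single i (weightSpaceEquiv hc hp i ⟨m, hm⟩), ?_⟩
    rw [LinearMap.sum_apply, Finset.sum_eq_single i]
    · simpa using hsection
    · intro j _ hji
      simp [hji]
    · simp

/-- The decomposition of a Weyl pair into weight spaces, each identified with the weight-`0` part
through a power of `X`. -/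
noncomputable def weightEquiv : (Fin l → P.weightSpace c 0) ≃ₗ[S] P :=
  LinearEquiv.ofBijective _ (sum_weightSection_bijective hc hp)

theorem weightEquiv_apply (v : Fin l → P.weightSpace c 0) :
    weightEquiv hc hp v = ∑ i, weightSection hc hp i (v i) := by
  simp [weightEquiv]

end Weights

end WeylPair

section QInt

variable {S : Type u} [CommRing S] (q : S) (n : ℕ)

theorem qInt_succ : qInt (n + 1) q = 1 + q * qInt n q := by
  rw [qInt, geom_sum_succ, qInt, add_comm]

theorem sub_one_mul_qInt : (q - 1) * qInt n q = q ^ n - 1 :=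
  mul_geom_sum q n

end QInt

namespace WeylPair

section Coinduction

variable {S : Type u} [CommRing S] {n : ℕ} {M : Type*} [AddCommGroup M] [Module S M]

/-- The operator `x` of the coinduced Weyl pair: it shifts the coordinates downwards and its
`(n + 1)`-st power acts on each of them as `X`. -/
def coindX (X : Module.End S M) : Module.End S (Fin (n + 1) → M) :=
  LinearMap.pi (Fin.snoc (α := fun _ ↦ (Fin (n + 1) → M) →ₗ[S] M)
    (fun j : Fin n ↦ LinearMap.proj j.succ) (X ∘ₗ LinearMap.proj 0))

/-- The operator `y` of the coinduced Weyl pair. Its coefficients come from the relation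
`x ^ (j + 1) y = p ^ (j + 1) y x ^ (j + 1) + [j + 1]_p r x ^ j`. -/
def coindY (p r : S) (X Y : Module.End S M) : Module.End S (Fin (n + 1) → M) :=
  LinearMap.pi (Fin.cons (α := fun _ ↦ (Fin (n + 1) → M) →ₗ[S] M)
    (Y ∘ₗ LinearMap.proj (Fin.last n))
    (fun j : Fin n ↦
      (p ^ (j + 1 : ℕ) • (Y * X) + (qInt (j + 1) p * r) • 1) ∘ₗ LinearMap.proj j.castSucc))

variable (p r : S) (X Y : Module.End S M) (v : Fin (n + 1) → M)

@[simp]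
theorem coindX_castSucc (j : Fin n) : coindX X v j.castSucc = v j.succ := by
  simp [coindX]

@[simp]
theorem coindX_last : coindX X v (Fin.last n) = X (v 0) := by
  simp [coindX]

@[simp]
theorem coindY_zero : coindY p r X Y v 0 = Y (v (Fin.last n)) := by
  simp [coindY]

@[simp]
theorem coindY_succ (j : Fin n) : coindY p r X Y v j.succ =
    p ^ (j + 1 : ℕ) • Y (X (v j.castSucc)) + (qInt (j + 1) p * r) • v j.castSucc := by
  simp [coindY]

theorem coindY_coindX_apply (i : Fin (n + 1)) : coindY p r X Y (coindX X v) i =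
    p ^ (i : ℕ) • Y (X (v i)) + (qInt i p * r) • v i := by
  cases i using Fin.cases with
  | zero => simp [qInt]
  | succ j => simp

variable {X Y p r} in
theorem coindX_mul_coindY (h : X * Y = p ^ (n + 1) • (Y * X) + (qInt (n + 1) p * r) • 1) :
    coindX X * coindY p r X Y =
      p • (coindY p r X Y * coindX X) + r • (1 : Module.End S (Fin (n + 1) → M)) := by
  have hXY (m : M) : X (Y m) = p ^ (n + 1) • Y (X m) + (qInt (n + 1) p * r) • m :=
    LinearMap.congr_fun h m
  refine LinearMap.ext fun v ↦ funext fun i ↦ ?_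
  simp only [LinearMap.add_apply, LinearMap.smul_apply, Module.End.mul_apply, Pi.add_apply,
    Pi.smul_apply, coindY_coindX_apply, Module.End.one_apply]
  cases i using Fin.lastCases with
  | last =>
    simp only [coindX_last, coindY_zero, hXY, Fin.val_last, qInt_succ, pow_succ]
    module
  | cast j =>
    simp only [coindX_castSucc, coindY_succ, Fin.val_castSucc, qInt_succ, pow_succ]
    module

theorem coindX_pow_apply_zero (i : Fin (n + 1)) : (coindX X ^ (i : ℕ)) v 0 = v i := by
  induction i using Fin.induction generalizing v with
  | zero => simp
  | succ j ih =>
    rw [Fin.val_succ, pow_succ, Module.End.mul_apply]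
    exact (ih (coindX X v)).trans (coindX_castSucc X v j)

theorem coindX_pow_succ_apply (i : Fin (n + 1)) : (coindX X ^ (n + 1)) v i = X (v i) := by
  have hzero (w : Fin (n + 1) → M) : (coindX X ^ (n + 1)) w 0 = X (w 0) := by
    rw [pow_succ, Module.End.mul_apply, ← coindX_last X w]
    exact coindX_pow_apply_zero X (coindX X w) (Fin.last n)
  rw [← coindX_pow_apply_zero X ((coindX X ^ (n + 1)) v) i, ← Module.End.mul_apply,
    pow_mul_comm, Module.End.mul_apply, hzero, coindX_pow_apply_zero]

variable {X} in
theorem exists_coindX_pow_apply_eq_zero (h : ∀ m, ∃ k : ℕ, (X ^ k) m = 0) :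
    ∃ k : ℕ, (coindX X ^ k) v = 0 := by
  choose k hk using h
  have hpow (j : ℕ) (i : Fin (n + 1)) : ((coindX X ^ (n + 1)) ^ j) v i = (X ^ j) (v i) := by
    induction j with
    | zero => simp
    | succ j ih => simp only [pow_succ' _ j, Module.End.mul_apply, coindX_pow_succ_apply, ih]
  refine ⟨(n + 1) * ∑ i, k (v i), funext fun i ↦ ?_⟩
  rw [pow_mul, hpow]
  exact Module.End.pow_map_zero_of_le
    (Finset.single_le_sum (f := fun i ↦ k (v i)) (fun _ _ ↦ Nat.zero_le _) (Finset.mem_univ i))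
    (hk (v i))

/-- The coinduction functor, from Weyl pairs over `A_{p ^ (n + 1), [n + 1]_p r}(S)` to Weyl pairs
over `A_{p,r}(S)`. -/
def coind (p r : S) (n : ℕ) :
    WeylPair.{u, v} (p ^ (n + 1)) (qInt (n + 1) p * r) ⥤ WeylPair.{u, v} p r where
  obj P :=
    { carrier := Fin (n + 1) → P
      X := coindX P.X
      Y := coindY p r P.X P.Y
      X_mul_Y := coindX_mul_coindY P.X_mul_Y
      exists_X_pow_apply_eq_zero v :=
        exists_coindX_pow_apply_eq_zero v P.exists_X_pow_apply_eq_zero }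
  map {P Q} f :=
    { toLinearMap := f.toLinearMap.compLeft (Fin (n + 1))
      map_X := fun (v : Fin (n + 1) → P) ↦ funext fun i ↦ by
        cases i using Fin.lastCases <;> simp [f.map_X]
      map_Y := fun (v : Fin (n + 1) → P) ↦ funext fun i ↦ by
        cases i using Fin.cases <;> simp [f.map_X, f.map_Y] }

variable {p r}

instance : (coind.{u, v} p r n).Faithful where
  map_injective {P Q} f g h := by
    ext m
    exact congrFun congr(($h).toLinearMap (fun _ ↦ m)) 0

end Coinduction

section Full

variable {S : Type u} [CommRing S] {p r c : S} {n : ℕ}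
  {P Q : WeylPair.{u, v} (p ^ (n + 1)) (qInt (n + 1) p * r)}
  (hc : 1 + c * r = p) (hp : IsPrimitiveRootModNilpotent p (n + 1))

include hc

theorem gradingOp_coind_apply (v : Fin (n + 1) → P) (i : Fin (n + 1)) :
    ((coind p r n).obj P).gradingOp c v i = p ^ (i : ℕ) • P.gradingOp c (v i) := by
  have hcoord : ((coind p r n).obj P).gradingOp c v i =
      v i + c • coindY p r P.X P.Y (coindX P.X v) i := rfl
  have hpow : 1 + c * (qInt i p * r) = p ^ (i : ℕ) := by
    linear_combination sub_one_mul_qInt p i + qInt i p * hc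
  rw [hcoord, coindY_coindX_apply, gradingOp_apply, ← hpow]
  module

include hp

theorem mem_maxGenEigenspace_pow_smul_gradingOp (i : ℕ) (m : P) :
    m ∈ (p ^ i • P.gradingOp c).maxGenEigenspace (p ^ i) := by
  have hc' : 1 + c * (qInt (n + 1) p * r) = p ^ (n + 1) := by
    linear_combination sub_one_mul_qInt p (n + 1) + qInt (n + 1) p * hc
  have htop : (P.gradingOp c).maxGenEigenspace 1 = ⊤ := by
    simpa [weightSpace] using iSup_weightSpace_eq_top (P := P) hc' hp.pow_order
  have hle := (maxGenEigenspace_smul (P.gradingOp c) (hp.isUnit.pow i) 1).ge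
  rw [htop, mul_one] at hle
  exact hle trivial

theorem single_mem_weightSpace_coind (j : Fin (n + 1)) (m : P) :
    Pi.single j m ∈ ((coind p r n).obj P).weightSpace c j := by
  refine map_mem_maxGenEigenspace (f := LinearMap.single S (fun _ ↦ P.carrier) j)
    (LinearMap.ext fun m ↦ funext fun i ↦ ?_) (mem_maxGenEigenspace_pow_smul_gradingOp hc hp j m)
  refine Eq.trans ?_ (gradingOp_coind_apply hc (Pi.single j m) i).symm
  obtain rfl | hij := eq_or_ne i j
  · simp
  · simp [hij]

theorem apply_eq_zero_of_mem_weightSpace_coind {v : Fin (n + 1) → P} {i j : Fin (n + 1)}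
    (hv : v ∈ ((coind p r n).obj P).weightSpace c j) (hij : i ≠ j) : v i = 0 := by
  have hvi : v i ∈ (p ^ (i : ℕ) • P.gradingOp c).maxGenEigenspace (p ^ (j : ℕ)) :=
    map_mem_maxGenEigenspace (f := LinearMap.proj i)
      (LinearMap.ext fun w ↦ gradingOp_coind_apply hc w i) hv
  exact Submodule.disjoint_def.1 ((iSupIndep_maxGenEigenspace_of_isUnit_sub
    (p ^ (i : ℕ) • P.gradingOp c) hp.pairwise_isUnit_pow_sub_pow).pairwiseDisjoint hij) _
    (mem_maxGenEigenspace_pow_smul_gradingOp hc hp i (v i)) hvi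

theorem exists_map_coind_apply (F : (coind p r n).obj P ⟶ (coind p r n).obj Q) :
    ∃ g : P →ₗ[S] Q, ∀ (v : Fin (n + 1) → P) (i : Fin (n + 1)), F.toLinearMap v i = g (v i) := by
  let f : (Fin (n + 1) → P) →ₗ[S] (Fin (n + 1) → Q) := F.toLinearMap
  have hX (v : Fin (n + 1) → P) : f (coindX P.X v) = coindX Q.X (f v) := F.map_X v
  refine ⟨LinearMap.proj 0 ∘ₗ f ∘ₗ LinearMap.single S (fun _ ↦ P.carrier) 0, fun v i ↦ ?_⟩
  change f v i = f (Pi.single 0 (v i)) 0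
  induction i using Fin.induction generalizing v with
  | zero =>
    have hzero (j : Fin (n + 1)) (hj : j ≠ 0) : f (Pi.single j (v j)) 0 = 0 :=
      apply_eq_zero_of_mem_weightSpace_coind hc hp
        (F.map_mem_weightSpace (single_mem_weightSpace_coind hc hp j (v j))) hj.symm
    rw [← Finset.univ_sum_single v, map_sum, Finset.sum_apply,
      Finset.sum_eq_single 0 (fun j _ ↦ by simpa using hzero j) (by simp)]
    simp
  | succ j ih => rw [← coindX_castSucc P.X v, ← ih, hX, coindX_castSucc]

theorem coind_full : (coind.{u, v} p r n).Full where
  map_surjective {P Q} F := by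
    obtain ⟨g, hg⟩ := exists_map_coind_apply hc hp F
    let f : (Fin (n + 1) → P) →ₗ[S] (Fin (n + 1) → Q) := F.toLinearMap
    have hf (v : Fin (n + 1) → P) (i : Fin (n + 1)) : f v i = g (v i) := hg v i
    refine ⟨⟨g, fun m ↦ ?_, fun m ↦ ?_⟩, hom_ext <| LinearMap.ext fun v ↦ funext fun i ↦
      (hg v i).symm⟩
    · have hX : f (coindX P.X fun _ ↦ m) = coindX Q.X (f fun _ ↦ m) := F.map_X _
      simpa only [hf, coindX_last] using congrFun hX (Fin.last n)
    · have hY : f (coindY p r P.X P.Y fun _ ↦ m) = coindY p r Q.X Q.Y (f fun _ ↦ m) := F.map_Y _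
      simpa only [hf, coindY_zero] using congrFun hY 0

end Full

section EssSurj

variable {S : Type u} [CommRing S] {p r c : S} {n : ℕ} {P : WeylPair.{u, v} p r}

theorem X_pow_succ_Y_apply (P : WeylPair.{u, v} p r) (j : ℕ) (m : P) :
    (P.X ^ (j + 1)) (P.Y m) =
      p ^ (j + 1) • P.Y ((P.X ^ (j + 1)) m) + (qInt (j + 1) p * r) • (P.X ^ j) m := by
  induction j generalizing m with
  | zero => simp [qInt, X_Y_apply]
  | succ j ih =>
    rw [pow_succ, Module.End.mul_apply, X_Y_apply, map_add, map_smul, map_smul, ih,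
      qInt_succ p (j + 1)]
    simp only [pow_succ, Module.End.mul_apply]
    module

variable (hc : 1 + c * r = p) (hp : IsPrimitiveRootModNilpotent p (n + 1))

include hp in
theorem mem_weightSpace_order_iff {m : P} :
    m ∈ P.weightSpace c (n + 1) ↔ m ∈ P.weightSpace c 0 := by
  rw [← zero_add (n + 1), weightSpace_add_order hp]

include hc hp

theorem X_pow_order_mem_weightSpace {m : P} (hm : m ∈ P.weightSpace c 0) :
    (P.X ^ (n + 1)) m ∈ P.weightSpace c 0 := by
  rw [pow_succ]
  exact (X_pow_bijOn_weightSpace hc hp n.lt_succ_self).mapsTo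
    (X_mem_weightSpace hc hp.isUnit ((mem_weightSpace_order_iff hp).2 hm))

theorem Y_weightSection_last_mem_weightSpace (ν : P.weightSpace c 0) :
    P.Y (weightSection hc hp (Fin.last n) ν) ∈ P.weightSpace c 0 :=
  (mem_weightSpace_order_iff hp).1 <|
    Y_mem_weightSpace hc hp.isUnit (weightSection_mem hc hp (Fin.last n) ν)

theorem weightSection_zero (ν : P.weightSpace c 0) : weightSection hc hp 0 ν = (ν : P) :=
  X_pow_weightSection hc hp 0 ν

theorem X_pow_succ_weightSection (i : Fin (n + 1)) (ν : P.weightSpace c 0) :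
    (P.X ^ (i + 1 : ℕ)) (weightSection hc hp i ν) = P.X ν := by
  rw [pow_succ', Module.End.mul_apply, X_pow_weightSection]

theorem X_weightSection_succ (j : Fin n) (ν : P.weightSpace c 0) :
    P.X (weightSection hc hp j.succ ν) = weightSection hc hp j.castSucc ν := by
  have hmem : P.X (weightSection hc hp j.succ ν) ∈ P.weightSpace c j.castSucc :=
    X_mem_weightSpace hc hp.isUnit (weightSection_mem hc hp j.succ ν)
  symm
  rw [weightSection_eq_iff hc hp hmem, ← Module.End.mul_apply, ← pow_succ]
  exact X_pow_weightSection hc hp j.succ ν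

/-- The operator `x` of the weight-`0` part. -/
def weightZeroX : Module.End S (P.weightSpace c 0) :=
  (P.X ^ (n + 1)).restrict fun _ ↦ X_pow_order_mem_weightSpace hc hp

/-- The operator `y` of the weight-`0` part: `Y` after the inverse of `X ^ n`. -/
noncomputable def weightZeroY : Module.End S (P.weightSpace c 0) :=
  (P.Y ∘ₗ weightSection hc hp (Fin.last n)).codRestrict _
    (Y_weightSection_last_mem_weightSpace hc hp)

variable (ν : P.weightSpace c 0)

theorem coe_weightZeroX_apply : (weightZeroX hc hp ν : P) = (P.X ^ (n + 1)) ν :=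
  rfl

theorem coe_weightZeroY_apply : (weightZeroY hc hp ν : P) =
    P.Y (weightSection hc hp (Fin.last n) ν) :=
  rfl

theorem weightSection_last_weightZeroX :
    weightSection hc hp (Fin.last n) (weightZeroX hc hp ν) = P.X ν := by
  have hmem : P.X ν ∈ P.weightSpace c n :=
    X_mem_weightSpace hc hp.isUnit ((mem_weightSpace_order_iff hp).2 ν.2)
  exact (weightSection_eq_iff hc hp (i := Fin.last n) hmem).2 rfl

theorem Y_weightSection_castSucc (j : Fin n) :
    P.Y (weightSection hc hp j.castSucc ν) = weightSection hc hp j.succ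
      (p ^ (j + 1 : ℕ) • weightZeroY hc hp (weightZeroX hc hp ν) + (qInt (j + 1) p * r) • ν) := by
  have hmem : P.Y (weightSection hc hp j.castSucc ν) ∈ P.weightSpace c j.succ :=
    Y_mem_weightSpace hc hp.isUnit (weightSection_mem hc hp j.castSucc ν)
  have hX := X_pow_succ_weightSection hc hp j.castSucc ν
  have hν := X_pow_weightSection hc hp j.castSucc ν
  rw [Fin.val_castSucc] at hX hν
  symm
  rw [weightSection_eq_iff hc hp hmem, Fin.val_succ, X_pow_succ_Y_apply, hX, hν,
    Submodule.coe_add, Submodule.coe_smul, Submodule.coe_smul, coe_weightZeroY_apply,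
    weightSection_last_weightZeroX]

theorem weightZeroX_mul_weightZeroY : weightZeroX hc hp * weightZeroY hc hp =
    p ^ (n + 1) • (weightZeroY hc hp * weightZeroX hc hp) +
      (qInt (n + 1) p * r) • (1 : Module.End S (P.weightSpace c 0)) := by
  refine LinearMap.ext fun ν ↦ Subtype.ext ?_
  have hX := X_pow_succ_weightSection hc hp (Fin.last n) ν
  have hν := X_pow_weightSection hc hp (Fin.last n) ν
  rw [Fin.val_last] at hX hν
  simp only [LinearMap.add_apply, LinearMap.smul_apply, Module.End.mul_apply, Module.End.one_apply,
    Submodule.coe_add, Submodule.coe_smul, coe_weightZeroX_apply, coe_weightZeroY_apply,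
    weightSection_last_weightZeroX, X_pow_succ_Y_apply, hX, hν]

theorem exists_weightZeroX_pow_apply_eq_zero : ∃ k : ℕ, (weightZeroX hc hp ^ k) ν = 0 := by
  obtain ⟨k, hk⟩ := P.exists_X_pow_apply_eq_zero ν
  refine ⟨k, Subtype.ext ?_⟩
  rw [weightZeroX, Module.End.pow_restrict, LinearMap.coe_restrict_apply, ← pow_mul]
  exact Module.End.pow_map_zero_of_le (Nat.le_mul_of_pos_left k n.succ_pos) hk

/-- The weight-`0` part of a Weyl pair over `A_{p,r}(S)`, as a Weyl pair over
`A_{p ^ (n + 1), [n + 1]_p r}(S)`. -/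
noncomputable def weightZero : WeylPair.{u, v} (p ^ (n + 1)) (qInt (n + 1) p * r) where
  carrier := P.weightSpace c 0
  X := weightZeroX hc hp
  Y := weightZeroY hc hp
  X_mul_Y := weightZeroX_mul_weightZeroY hc hp
  exists_X_pow_apply_eq_zero := exists_weightZeroX_pow_apply_eq_zero hc hp

theorem weightEquiv_coindX (v : Fin (n + 1) → P.weightSpace c 0) :
    weightEquiv hc hp (coindX (weightZeroX hc hp) v) = P.X (weightEquiv hc hp v) := by
  rw [weightEquiv_apply, weightEquiv_apply, Fin.sum_univ_castSucc,
    Fin.sum_univ_succ, map_add, map_sum, add_comm]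
  congr 1
  · rw [coindX_last, weightSection_zero, weightSection_last_weightZeroX]
  · exact Finset.sum_congr rfl fun j _ ↦ by rw [coindX_castSucc, X_weightSection_succ]

theorem weightEquiv_coindY (v : Fin (n + 1) → P.weightSpace c 0) :
    weightEquiv hc hp (coindY p r (weightZeroX hc hp) (weightZeroY hc hp) v) =
      P.Y (weightEquiv hc hp v) := by
  rw [weightEquiv_apply, weightEquiv_apply,
    Fin.sum_univ_castSucc (fun i ↦ weightSection hc hp i (v i)), Fin.sum_univ_succ, map_add,
    map_sum, add_comm]
  congr 1
  · refine Finset.sum_congr rfl fun j _ ↦ ?_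
    rw [Y_weightSection_castSucc, coindY_succ]
  · rw [coindY_zero, weightSection_zero, coe_weightZeroY_apply]

theorem coind_essSurj : (coind.{u, v} p r n).EssSurj where
  mem_essImage P := ⟨weightZero (P := P) hc hp,
    ⟨isoMk (weightEquiv hc hp) (weightEquiv_coindX hc hp) (weightEquiv_coindY hc hp)⟩⟩

theorem coind_isEquivalence : (coind.{u, v} p r n).IsEquivalence where
  full := coind_full hc hp
  essSurj := coind_essSurj hc hp

end EssSurj

end WeylPair

theorem mainTheorem2_general {S : Type u} [CommRing S] {p r : S} {l : ℕ}
    (hp : IsPrimitiveRootModNilpotent p l) (hr : r ∣ p - 1) :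
    Nonempty (QuantizedWeyl.CategoryO.{u, v} p r ≌
      QuantizedWeyl.CategoryO.{u, v} (p ^ l) (qInt l p * r)) := by
  obtain ⟨n, rfl⟩ := Nat.exists_eq_add_of_lt hp.pos
  rw [zero_add] at hp ⊢
  obtain ⟨c, hc⟩ := hr
  have : (WeylPair.coind.{u, v} p r n).IsEquivalence :=
    WeylPair.coind_isEquivalence (c := c) (by linear_combination -hc) hp
  exact ⟨(QuantizedWeyl.toWeylPair p r).asEquivalence.trans <|
    (WeylPair.coind p r n).asEquivalence.symm.trans
      (QuantizedWeyl.toWeylPair _ _).asEquivalence.symm⟩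

theorem mainTheorem2 {k : Type w} [Field k] {S : Type u} [CommRing S] [Nontrivial S] [Algebra k S]
    (l : ℕ) (hl : 0 < l) (ζ : k) (hζ : IsPrimitiveRoot ζ l)
    (b : S) (hb : IsNilpotent b) (q : S) (hq : q = algebraMap k S ζ + b) :
    Nonempty (QuantizedWeyl.CategoryO.{u, v} q 1 ≌
      QuantizedWeyl.CategoryO.{u, v} (q ^ l) (qInt l q)) := by
  have hq' : IsPrimitiveRootModNilpotent q l := hq ▸ .algebraMap_add hζ hl hb
  have h := mainTheorem2_general.{u, v} hq' (one_dvd (q - 1))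
  rwa [mul_one] at h
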